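/- Let $n\ge 0$ and let $K$ be a centrally symmetric convex $(2n+4)$-gon with center $o$. All triangulations of $K$ are without new vertices and centrally symmetric with respect to $o$; each has exactly one diagonal through $o$ (its central diagonal), and its other $2n$ diagonals form $n$ centrally symmetric pairs. A flip of such a triangulation replaces either its central diagonal by another one, or both diagonals of a centrally symmetric pair simultaneously by those of another centrally symmetric pair, so that again a centrally symmetric triangulation results, all other diagonals being kept. The ordinary cyclohedron $\mathcal{Z}_n$ is the polytope of rank $n+1$ whose nonempty faces are given by their vertex sets $\{s : D\subseteq s\}$, where $D$ runs over the centrally symmetric sets of diagonals contained in some centrally symmetric triangulation and $s$ over all centrally symmetric triangulations; together with the empty face, they are ordered by inclusion. A colored triangulation is a centrally symmetric triangulation of $K$ whose $n$ pairs of non-central diagonals are colored bijectively with the elements of an $n$-set $C(K)$ of colors, the two diagonals of a pair receiving the same color; the central diagonal receives only the "uncolor" $c^*\notin C(K)$. Flips of colored triangulations preserve colors: the new diagonals receive the color of the ones they replace, and all other diagonals keep theirs. The colorful cyclohedron $\mathcal{Z}^c_n$ is the abstract polytope of rank $n+1$ whose nonempty faces are the pairs $(C,t)$, with $C\subseteq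 C(K)\cup\{c^*\}$ and $t$ a colored triangulation, identified with the set of all colored triangulations obtained from $t$ by sequences of flips of diagonals with colors in $C$; together with the empty face, they are ordered by inclusion. The symmetric group $S_n$ of permutations of $C(K)$ acts on $\mathcal{Z}^c_n$ by $\sigma(C,t)=(\sigma(C),t_\sigma)$, where $\sigma(c^*)=c^*$ and $t_\sigma$ is obtained from $t$ by replacing each color $c$ by $\sigma(c)$. The faces of the quotient $\mathcal{Z}^c_n/S_n$ are the orbits of faces of $\mathcal{Z}^c_n$ under $S_n$, with $P\le Q$ if and only if there are faces $F\in P$ and $G\in Q$ with $F\le G$. Theorem. For every $n\ge 0$, $$\mathcal{Z}^c_n/S_n\;\cong\;\mathcal{Z}_n$$ as partially ordered sets of faces (isomorphism of abstract polytopes). -/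

import Mathlib

namespace Cyclohedron

/-- The vertices of the centrally symmetric convex `(2n+4)`-gon `K`, labelled in cyclic order. -/
abbrev Vertex (n : ℕ) : Type := Fin (2 * n + 4)

/-- The central symmetry of `K` on vertices: `i ↦ i + (n + 2)` modulo `2n + 4`. -/
def opp {n : ℕ} (i : Vertex n) : Vertex n :=
  ⟨(i.val + (n + 2)) % (2 * n + 4), Nat.mod_lt _ (by omega)⟩

/-- The central symmetry of `K` on unordered pairs of vertices. -/
def oppPair {n : ℕ} (x : Sym2 (Vertex n)) : Sym2 (Vertex n) := Sym2.map opp x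

/-- A diagonal of `K` is a pair of vertices that are distinct and not neighbours on the boundary
(the last inequality excludes the side joining the last vertex to the first). -/
def IsDiagonal {n : ℕ} (x : Sym2 (Vertex n)) : Prop :=
  ∃ a b : Vertex n, x = s(a, b) ∧ a.val + 1 < b.val ∧ b.val + 1 < a.val + (2 * n + 4)

/-- A diagonal is central if it joins a vertex to the opposite vertex. -/
def IsCentral {n : ℕ} (x : Sym2 (Vertex n)) : Prop :=
  ∃ a : Vertex n, x = s(a, opp a)

/-- Two diagonals cross in the interior of `K`: their four end points are distinct and alternate
along the boundary. -/
def Crosses {n : ℕ} (x y : Sym2 (Vertex n)) : Prop :=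
  ∃ a b c d : Vertex n, a < c ∧ c < b ∧ b < d ∧
    ((x = s(a, b) ∧ y = s(c, d)) ∨ (x = s(c, d) ∧ y = s(a, b)))

/-- A set of pairwise non-crossing diagonals of `K`. -/
def IsNoncrossing {n : ℕ} (D : Set (Sym2 (Vertex n))) : Prop :=
  (∀ x ∈ D, IsDiagonal x) ∧ ∀ x ∈ D, ∀ y ∈ D, ¬ Crosses x y

/-- A triangulation of `K`, given by its diagonals: a maximal set of pairwise non-crossing
diagonals. -/
def IsTriangulation {n : ℕ} (D : Set (Sym2 (Vertex n))) : Prop :=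
  Maximal IsNoncrossing D

/-- The centrally symmetric (uncolored) triangulations of `K`. -/
@[ext]
structure SymTriangulation (n : ℕ) where
  /-- the set of diagonals -/
  diagonals : Set (Sym2 (Vertex n))
  isTriangulation : IsTriangulation diagonals
  symmetric : ∀ x ∈ diagonals, oppPair x ∈ diagonals

/-- `t'` is obtained from `t` by flipping `x` into `y` together with the flip of the opposite
diagonal of `x` into the opposite diagonal of `y` (if `x` is central, it is its own opposite and
this is a single flip): the old diagonals are exchanged for new ones, all the others being kept,
so that a triangulation results. -/
def IsFlip {n : ℕ} (t t' : SymTriangulation n) (x y : Sym2 (Vertex n)) : Prop :=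
  x ∈ t.diagonals ∧ y ∉ t.diagonals ∧
    t'.diagonals = (t.diagonals \ {x, oppPair x}) ∪ {y, oppPair y}

/-! ### The ordinary cyclohedron -/

/-- The vertex sets of the faces of the ordinary cyclohedron: the empty face, and, for each
centrally symmetric set `D` of diagonals of a centrally symmetric triangulation, the set of all
centrally symmetric triangulations that contain `D`. -/
def IsCyclohedronFace {n : ℕ} (F : Set (SymTriangulation n)) : Prop :=
  F = ∅ ∨ ∃ (t : SymTriangulation n) (D : Set (Sym2 (Vertex n))),
    D ⊆ t.diagonals ∧ (∀ x ∈ D, oppPair x ∈ D) ∧ F = {s | D ⊆ s.diagonals}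

/-- The ordinary cyclohedron, as an abstract polytope: its faces. -/
@[ext]
structure CyclohedronFace (n : ℕ) where
  /-- the vertex set of the face -/
  vertices : Set (SymTriangulation n)
  isFace : IsCyclohedronFace vertices

/-- Faces are ordered by inclusion of their vertex sets. -/
instance (n : ℕ) : PartialOrder (CyclohedronFace n) :=
  PartialOrder.lift CyclohedronFace.vertices (fun _ _ h => CyclohedronFace.ext h)

/-! ### The colorful cyclohedron -/

/-- The colored triangulations of `K`, with color set `Fin n`. Here `color x = some c` means that
`x` carries the color `c`; the pairs that are not diagonals of the triangulation, and its central
diagonal, carry no color, `color x = none`. Two non-central diagonals have the same color exactly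
if they are equal or opposite. -/
@[ext]
structure ColoredTriangulation (n : ℕ) where
  /-- the underlying uncolored triangulation -/
  supp : SymTriangulation n
  /-- the coloring -/
  color : Sym2 (Vertex n) → Option (Fin n)
  isSome_color_iff : ∀ x, (color x).isSome ↔ x ∈ supp.diagonals ∧ ¬ IsCentral x
  color_eq_iff : ∀ x ∈ supp.diagonals, ∀ y ∈ supp.diagonals, ¬ IsCentral x → ¬ IsCentral y →
    (color x = color y ↔ y = x ∨ y = oppPair x)

/-- `t'` is obtained from `t` by a color preserving flip of the diagonal or diagonals of color `c`,
where `c` lies in the extended color set `Option (Fin n)` and `none` is the "uncolor" of the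
central diagonal. -/
def IsColoredFlip {n : ℕ} (c : Option (Fin n)) (t t' : ColoredTriangulation n) : Prop :=
  ∃ x y, IsFlip t.supp t'.supp x y ∧ t.color x = c ∧ t'.color y = c ∧
    ∀ z ∈ t.supp.diagonals, z ∈ t'.supp.diagonals → t'.color z = t.color z

theorem oppPair_oppPair {n : ℕ} (x : Sym2 (Vertex n)) : oppPair (oppPair x) = x := by
  have h : (opp ∘ opp : Vertex n → Vertex n) = id := by
    funext i
    have hi := i.isLt
    apply Fin.ext
    simp only [Function.comp_apply, opp, id_eq]
    rcases Nat.lt_or_ge (i.val + (n + 2)) (2 * n + 4) with h1 | h1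
    · rw [Nat.mod_eq_of_lt h1, show i.val + (n + 2) + (n + 2) = i.val + (2 * n + 4) by omega,
        Nat.add_mod_right, Nat.mod_eq_of_lt hi]
    · have h2 : (i.val + (n + 2)) % (2 * n + 4) = i.val + (n + 2) - (2 * n + 4) := by
        rw [Nat.mod_eq_sub_mod h1, Nat.mod_eq_of_lt (by omega)]
      rw [h2, Nat.mod_eq_of_lt (by omega)]
      omega
  unfold oppPair
  rw [Sym2.map_map, h, Sym2.map_id, id]

theorem IsFlip.symm {n : ℕ} {t t' : SymTriangulation n} {x y : Sym2 (Vertex n)}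
    (h : IsFlip t t' x y) : IsFlip t' t y x := by
  obtain ⟨hx, hy, he⟩ := h
  have hx' := t.symmetric x hx
  have hy' : oppPair y ∉ t.diagonals := fun h => hy (by
    have := t.symmetric _ h
    rwa [oppPair_oppPair] at this)
  refine ⟨by rw [he]; simp, ?_, ?_⟩
  · rw [he]
    rintro (⟨-, h⟩ | h | h)
    · exact h (Or.inl rfl)
    · exact hy (h ▸ hx)
    · exact hy' ((show x = oppPair y from h) ▸ hx)
  · ext z
    rw [he]
    simp only [Set.mem_union, Set.mem_sdiff, Set.mem_insert_iff, Set.mem_singleton_iff]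
    constructor
    · intro hz
      by_cases h : z = x ∨ z = oppPair x
      · exact Or.inr h
      · refine Or.inl ⟨Or.inl ⟨hz, h⟩, ?_⟩
        rintro (rfl | rfl)
        · exact hy hz
        · exact hy' hz
    · rintro (⟨⟨h, -⟩ | h, h2⟩ | rfl | rfl)
      · exact h
      · exact absurd h h2
      · exact hx
      · exact hx'

theorem IsColoredFlip.symm {n : ℕ} {c : Option (Fin n)} {t t' : ColoredTriangulation n}
    (h : IsColoredFlip c t t') : IsColoredFlip c t' t := by
  obtain ⟨x, y, h, hx, hy, hz⟩ := h
  exact ⟨y, x, h.symm, hy, hx, fun z h1 h2 => (hz z h2 h1).symm⟩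

theorem IsColoredFlip.ne {n : ℕ} {c : Option (Fin n)} {t t' : ColoredTriangulation n}
    (h : IsColoredFlip c t t') : t ≠ t' := by
  rintro rfl
  obtain ⟨x, y, h, -⟩ := h
  exact h.2.1 h.symm.1

/-- The edges with colors in `C` of the colorful exchange graph: two colored triangulations are
adjacent if they differ by a color preserving flip of the diagonals of one color `c ∈ C`.
For `C = Set.univ` this is the whole colorful exchange graph. -/
def exchangeGraph {n : ℕ} (C : Set (Option (Fin n))) : SimpleGraph (ColoredTriangulation n) where
  Adj t t' := ∃ c ∈ C, IsColoredFlip c t t'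
  symm := ⟨fun _ _ ⟨c, hc, h⟩ => ⟨c, hc, h.symm⟩⟩
  loopless := ⟨fun _ ⟨_, _, h⟩ => h.ne rfl⟩

/-- The vertex set of the face `(C, t)` of the colorful cyclohedron: all colored triangulations
that are joined to `t` by a path in the colorful exchange graph with edge colors in `C`. -/
def faceVertices {n : ℕ} (C : Set (Option (Fin n))) (t : ColoredTriangulation n) :
    Set (ColoredTriangulation n) :=
  {s | (exchangeGraph C).Reachable t s}

/-- The vertex sets of the faces of the colorful cyclohedron: the empty face and the `(C, t)`. -/
def IsColorfulFace {n : ℕ} (F : Set (ColoredTriangulation n)) : Prop :=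
  F = ∅ ∨ ∃ (C : Set (Option (Fin n))) (t : ColoredTriangulation n), F = faceVertices C t

/-- The colorful cyclohedron, as an abstract polytope: its faces. -/
@[ext]
structure ColorfulCyclohedronFace (n : ℕ) where
  /-- the vertex set of the face -/
  vertices : Set (ColoredTriangulation n)
  isFace : IsColorfulFace vertices

/-- Faces are ordered by inclusion of their vertex sets. -/
instance (n : ℕ) : PartialOrder (ColorfulCyclohedronFace n) :=
  PartialOrder.lift ColorfulCyclohedronFace.vertices (fun _ _ h => ColorfulCyclohedronFace.ext h)

/-! ### The action of the symmetric group on the colors -/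

/-- `recolor σ t` replaces each color `c` of `t` by `σ c`. -/
def recolor {n : ℕ} (σ : Equiv.Perm (Fin n)) (t : ColoredTriangulation n) :
    ColoredTriangulation n where
  supp := t.supp
  color x := (t.color x).map σ
  isSome_color_iff x := by rw [Option.isSome_map]; exact t.isSome_color_iff x
  color_eq_iff x hx y hy hx' hy' := by
    rw [(Option.map_injective σ.injective).eq_iff]
    exact t.color_eq_iff x hx y hy hx' hy'

instance (n : ℕ) : MulAction (Equiv.Perm (Fin n)) (ColoredTriangulation n) where
  smul := recolor
  one_smul t := by
    apply ColoredTriangulation.ext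
    · rfl
    · funext x
      change (t.color x).map (1 : Equiv.Perm (Fin n)) = t.color x
      simp
  mul_smul σ τ t := by
    apply ColoredTriangulation.ext
    · rfl
    · funext x
      change (t.color x).map (σ * τ : Equiv.Perm (Fin n)) = ((t.color x).map τ).map σ
      simp [Option.map_map]

theorem IsColoredFlip.smul {n : ℕ} {c : Option (Fin n)} {t t' : ColoredTriangulation n}
    (h : IsColoredFlip c t t') (σ : Equiv.Perm (Fin n)) :
    IsColoredFlip (c.map σ) (σ • t) (σ • t') := by
  obtain ⟨x, y, h, hx, hy, hz⟩ := h
  exact ⟨x, y, h, congrArg (Option.map σ) hx, congrArg (Option.map σ) hy,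
    fun z h1 h2 => congrArg (Option.map σ) (hz z h1 h2)⟩

theorem reachable_smul {n : ℕ} {C : Set (Option (Fin n))} {t s : ColoredTriangulation n}
    (h : (exchangeGraph C).Reachable t s) (σ : Equiv.Perm (Fin n)) :
    (exchangeGraph (Option.map σ '' C)).Reachable (σ • t) (σ • s) :=
  h.map (G' := exchangeGraph (Option.map σ '' C))
    { toFun := fun t => σ • t
      map_rel' := by
        rintro t s ⟨c, hc, h⟩
        exact ⟨c.map σ, ⟨c, hc, rfl⟩, h.smul σ⟩ }

/-- A permutation `σ` of the colors maps the face `(C, t)` to the face `(σ(C), σ • t)`. -/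
theorem image_smul_faceVertices {n : ℕ} (σ : Equiv.Perm (Fin n)) (C : Set (Option (Fin n)))
    (t : ColoredTriangulation n) :
    (fun s => σ • s) '' faceVertices C t = faceVertices (Option.map σ '' C) (σ • t) := by
  ext s
  constructor
  · rintro ⟨s, hs, rfl⟩
    exact reachable_smul hs σ
  · intro hs
    refine ⟨σ⁻¹ • s, ?_, smul_inv_smul σ s⟩
    have := reachable_smul hs σ⁻¹
    rw [inv_smul_smul, Set.image_image] at this
    simpa [faceVertices, Option.map_map] using this

/-- The symmetric group on the `n` colors acts on the faces of the colorful cyclohedron, a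
permutation moving every vertex of a face. -/
instance (n : ℕ) : MulAction (Equiv.Perm (Fin n)) (ColorfulCyclohedronFace n) where
  smul σ F := ⟨(fun s => σ • s) '' F.vertices, by
    rcases F.isFace with h | ⟨C, t, h⟩
    · left; rw [h, Set.image_empty]
    · right; exact ⟨_, _, by rw [h, image_smul_faceVertices]⟩⟩
  one_smul F := by
    apply ColorfulCyclohedronFace.ext
    change (fun s => (1 : Equiv.Perm (Fin n)) • s) '' F.vertices = F.vertices
    simp
  mul_smul σ τ F := by
    apply ColorfulCyclohedronFace.ext
    change (fun s => (σ * τ) • s) '' F.vertices =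
      (fun s => σ • s) '' ((fun s => τ • s) '' F.vertices)
    rw [Set.image_image]
    simp [mul_smul]

/-- The faces of the quotient of the colorful cyclohedron by the symmetric group on the colors:
the orbits of faces. -/
def QuotientFace (n : ℕ) : Type :=
  MulAction.orbitRel.Quotient (Equiv.Perm (Fin n)) (ColorfulCyclohedronFace n)

/-- The orbit of a face. -/
def orbit {n : ℕ} (F : ColorfulCyclohedronFace n) : QuotientFace n :=
  Quotient.mk (MulAction.orbitRel (Equiv.Perm (Fin n)) (ColorfulCyclohedronFace n)) F

/-- Two orbits are incident in the quotient if they are the orbits of two incident faces. -/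
instance (n : ℕ) : LE (QuotientFace n) where
  le P Q := ∃ F G : ColorfulCyclohedronFace n, orbit F = P ∧ orbit G = Q ∧ F ≤ G

end Cyclohedron

/-!
Forgetting the colors sends the face `(C, t)` to the set of triangulations that contain the
diagonals of `t` with color outside `C`. That all of these are reached amounts to two facts: flips
lift to colored triangulations, and the symmetric triangulations that contain a given symmetric set
`D` of diagonals are connected by flips keeping `D`.

For the second fact, let `y` be a diagonal crossing no element of `D`, and `a` an end point of `y`.
As long as `y` is absent, some flip that introduces an edge at `a` removes a diagonal crossing `y`.
The opposite flip could interfere by creating a new crossing with `y`; it does not if `y` is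
central, or if `D` contains a central diagonal that avoids `a`. One therefore first makes the
central diagonals agree, and then the other pairs one after the other.

Finally, the colorings of one triangulation form a single orbit of the symmetric group. A face whose
uncolored version lies below that of another face can thus be given a vertex in common with a
recolored copy of the latter, and faces with a common vertex are compared by their fixed diagonals.
-/

namespace Cyclohedron

variable {n : ℕ}

/-! ### Crossing chords in the circular order -/

theorem sbtw_or_sbtw_of_ne {α : Type*} [CircularOrder α] {a b c d : α} (h : sbtw a c b)
    (hdc : d ≠ c) : sbtw a c d ∨ sbtw d c b := by
  refine or_iff_not_imp_left.2 fun hacd => ?_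
  obtain rfl | hda := eq_or_ne d a
  · exact h
  have hca : c ≠ a := by
    rintro rfl
    exact sbtw_irrefl_left h
  have hdca : btw d c a := btw_iff_not_sbtw.2 hacd
  have hcad : sbtw c a d := (sbtw_of_btw_not_btw hdca fun hacd' =>
    (hdca.antisymm hacd').elim hdc (·.elim hca (hda ·.symm))).cyclic_left
  exact (sbtw_trans_right h.cyclic_left hcad).cyclic_right

theorem crosses_mk_right {a b : Vertex n} {z : Sym2 (Vertex n)} :
    Crosses z s(a, b) ↔ ∃ c d, z = s(c, d) ∧ sbtw a c b ∧ sbtw b d a := by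
  simp only [Fin.sbtw_iff]
  constructor
  · rintro ⟨p, q, r, s, hpr, hrq, hqs, ⟨rfl, hab⟩ | ⟨rfl, hab⟩⟩ <;>
      obtain ⟨rfl, rfl⟩ | ⟨rfl, rfl⟩ := Sym2.eq_iff.1 hab
    · exact ⟨q, p, Sym2.eq_swap, by lia⟩
    · exact ⟨p, q, rfl, by lia⟩
    · exact ⟨r, s, rfl, by lia⟩
    · exact ⟨s, r, Sym2.eq_swap, by lia⟩
  · rintro ⟨c, d, rfl, hacb, hbda⟩
    obtain h | h | h | h : (a < c ∧ c < b ∧ b < d) ∨ (c < b ∧ b < d ∧ d < a) ∨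
        (b < d ∧ d < a ∧ a < c) ∨ (d < a ∧ a < c ∧ c < b) := by lia
    · exact ⟨a, b, c, d, h.1, h.2.1, h.2.2, Or.inr ⟨rfl, rfl⟩⟩
    · exact ⟨c, d, b, a, h.1, h.2.1, h.2.2, Or.inl ⟨rfl, Sym2.eq_swap⟩⟩
    · exact ⟨b, a, d, c, h.1, h.2.1, h.2.2, Or.inr ⟨Sym2.eq_swap, Sym2.eq_swap⟩⟩
    · exact ⟨d, c, a, b, h.1, h.2.1, h.2.2, Or.inl ⟨Sym2.eq_swap, rfl⟩⟩

theorem crosses_of_sbtw {a b c d : Vertex n} (hc : sbtw a c b) (hd : sbtw b d a) :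
    Crosses s(c, d) s(a, b) :=
  crosses_mk_right.2 ⟨c, d, rfl, hc, hd⟩

theorem Crosses.symm {x y : Sym2 (Vertex n)} (h : Crosses x y) : Crosses y x := by
  obtain ⟨a, b, c, d, hac, hcb, hbd, h⟩ := h
  exact ⟨a, b, c, d, hac, hcb, hbd, h.symm.imp And.symm And.symm⟩

theorem not_crosses_of_mem {v : Vertex n} {x y : Sym2 (Vertex n)} (hx : v ∈ x) (hy : v ∈ y) :
    ¬ Crosses x y := by
  induction y with | _ a b =>
  intro h
  obtain ⟨c, d, rfl, hc, hd⟩ := crosses_mk_right.1 h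
  obtain rfl | rfl := Sym2.mem_iff.1 hx <;> obtain rfl | rfl := Sym2.mem_iff.1 hy
  exacts [sbtw_irrefl_left hc, sbtw_irrefl_right hc, sbtw_irrefl_right hd, sbtw_irrefl_left hd]

theorem not_crosses_self (x : Sym2 (Vertex n)) : ¬ Crosses x x :=
  not_crosses_of_mem x.out_fst_mem x.out_fst_mem

theorem isDiagonal_iff_exists_crosses {x : Sym2 (Vertex n)} :
    IsDiagonal x ↔ ∃ y, Crosses x y := by
  constructor
  · rintro ⟨a, b, rfl, hab, hba⟩
    obtain ⟨u, hu⟩ : ∃ u : Vertex n, u.val = a.val + 1 := ⟨⟨_, by lia⟩, rfl⟩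
    obtain ⟨v, hv⟩ : ∃ v : Vertex n, v.val = b.val + 1 ∨ b.val = 2 * n + 3 ∧ v.val = 0 := by
      obtain hb | hb := lt_or_ge (b.val + 1) (2 * n + 4)
      · exact ⟨⟨_, hb⟩, Or.inl rfl⟩
      · exact ⟨⟨0, by lia⟩, Or.inr ⟨by lia, rfl⟩⟩
    exact ⟨s(u, v), (crosses_of_sbtw (Fin.sbtw_iff.2 (by lia)) (Fin.sbtw_iff.2 (by lia))).symm⟩
  · rintro ⟨y, a, b, c, d, hac, hcb, hbd, ⟨rfl, rfl⟩ | ⟨rfl, rfl⟩⟩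
    · exact ⟨a, b, rfl, by lia, by lia⟩
    · exact ⟨c, d, rfl, by lia, by lia⟩

theorem Crosses.isDiagonal {x y : Sym2 (Vertex n)} (h : Crosses x y) : IsDiagonal x :=
  isDiagonal_iff_exists_crosses.2 ⟨y, h⟩

theorem not_isDiagonal_diag (a : Vertex n) : ¬ IsDiagonal s(a, a) := fun h => by
  obtain ⟨y, hy⟩ := isDiagonal_iff_exists_crosses.1 h
  obtain ⟨c, -, -, hc, -⟩ := crosses_mk_right.1 hy.symm
  exact sbtw_irrefl_left_right hc

theorem Crosses.exists_eq_mk_of_triangle {p q r : Vertex n} {z : Sym2 (Vertex n)}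
    (hr : sbtw p r q) (hz : Crosses z s(r, q)) (hpq : ¬ Crosses z s(p, q))
    (hpr : ¬ Crosses z s(p, r)) : ∃ e, z = s(p, e) ∧ sbtw r e q := by
  obtain ⟨e, f, rfl, he, hf⟩ := crosses_mk_right.1 hz
  obtain rfl | hpf := eq_or_ne p f
  · exact ⟨e, Sym2.eq_swap, he⟩
  obtain hf' | hf' := sbtw_or_sbtw_of_ne hf hpf
  · exact absurd (crosses_of_sbtw (hr.trans_left he) hf') hpq
  · rw [Sym2.eq_swap] at hpr
    exact absurd (crosses_of_sbtw hf' (sbtw_trans_right he hr.cyclic_left)) hpr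

theorem Crosses.eq_mk_of_quadrilateral {a p r q : Vertex n} {z : Sym2 (Vertex n)}
    (hr : sbtw p r q) (ha : sbtw q a p) (hz : Crosses z s(p, q)) (hap : ¬ Crosses z s(a, p))
    (hpr : ¬ Crosses z s(p, r)) (hrq : ¬ Crosses z s(r, q)) (hqa : ¬ Crosses z s(q, a)) :
    z = s(a, r) := by
  have haz : a ∈ z := by
    obtain ⟨e, rfl, -⟩ :=
      hz.exists_eq_mk_of_triangle ha.cyclic_left (by rwa [Sym2.eq_swap]) hap
    exact Sym2.mem_mk_left _ _
  have hrz : r ∈ z := by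
    obtain ⟨e, rfl, -⟩ := (show Crosses z s(q, p) by rwa [Sym2.eq_swap]).exists_eq_mk_of_triangle
      hr.cyclic_left (by rwa [Sym2.eq_swap]) hrq
    exact Sym2.mem_mk_left _ _
  have har : a ≠ r := by
    rintro rfl
    exact sbtw_asymm hr ha
  exact (Sym2.mem_and_mem_iff har).1 ⟨haz, hrz⟩

/-! ### The central symmetry -/

theorem opp_cases (a : Vertex n) :
    (a.val < n + 2 ∧ (opp a).val = a.val + (n + 2)) ∨
      (n + 2 ≤ a.val ∧ (opp a).val + (n + 2) = a.val) := by
  have hval : (opp a).val = (a.val + (n + 2)) % (2 * n + 4) := rfl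
  obtain h | h := lt_or_ge a.val (n + 2)
  · exact Or.inl ⟨h, by rw [hval, Nat.mod_eq_of_lt (by lia)]⟩
  · exact Or.inr ⟨h, by rw [hval, Nat.mod_eq_sub_mod (by lia), Nat.mod_eq_of_lt (by lia)]; lia⟩

@[simp] theorem oppPair_mk (a b : Vertex n) : oppPair s(a, b) = s(opp a, opp b) := rfl

theorem opp_opp (a : Vertex n) : opp (opp a) = a := by
  have := opp_cases a
  have := opp_cases (opp a)
  lia

theorem opp_ne (a : Vertex n) : opp a ≠ a := by
  have := opp_cases a
  lia

theorem sbtw_opp {a b c : Vertex n} (h : sbtw a b c) : sbtw (opp a) (opp b) (opp c) := by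
  have ha := opp_cases a
  have hb := opp_cases b
  have hc := opp_cases c
  rw [Fin.sbtw_iff] at h ⊢
  lia

theorem crosses_oppPair {x y : Sym2 (Vertex n)} :
    Crosses (oppPair x) (oppPair y) ↔ Crosses x y := by
  have oppPair_of_crosses : ∀ {x y : Sym2 (Vertex n)}, Crosses x y →
      Crosses (oppPair x) (oppPair y) := by
    intro x y h
    induction y with | _ a b =>
    obtain ⟨c, d, rfl, hc, hd⟩ := crosses_mk_right.1 h
    exact crosses_of_sbtw (sbtw_opp hc) (sbtw_opp hd)
  exact ⟨fun h => by simpa only [oppPair_oppPair] using oppPair_of_crosses h, oppPair_of_crosses⟩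

theorem isDiagonal_oppPair {x : Sym2 (Vertex n)} : IsDiagonal (oppPair x) ↔ IsDiagonal x := by
  simp only [isDiagonal_iff_exists_crosses]
  refine ⟨fun ⟨y, hy⟩ => ⟨oppPair y, ?_⟩, fun ⟨y, hy⟩ => ⟨oppPair y, crosses_oppPair.2 hy⟩⟩
  rwa [← crosses_oppPair, oppPair_oppPair]

theorem not_crosses_oppPair (x : Sym2 (Vertex n)) : ¬ Crosses (oppPair x) x := by
  induction x with | _ a b =>
  intro h
  obtain ⟨c, d, hcd, hc, hd⟩ := crosses_mk_right.1 h
  have ha := opp_cases a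
  have hb := opp_cases b
  rw [Fin.sbtw_iff] at hc hd
  obtain ⟨rfl, rfl⟩ | ⟨rfl, rfl⟩ := Sym2.eq_iff.1 hcd <;> lia

/-! ### Triangles -/

/-- The chord `x` crosses no chord of `D`. For a triangulation `D` this means that `x` is a diagonal
in `D`, a side of the polygon, or a single point. -/
def Uncrossed (D : Set (Sym2 (Vertex n))) (x : Sym2 (Vertex n)) : Prop :=
  ∀ z ∈ D, ¬ Crosses z x

theorem uncrossed_of_not_isDiagonal (D : Set (Sym2 (Vertex n))) {x : Sym2 (Vertex n)}
    (hx : ¬ IsDiagonal x) : Uncrossed D x :=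
  fun _ _ h => hx h.symm.isDiagonal

theorem isTriangulation_iff {D : Set (Sym2 (Vertex n))} :
    IsTriangulation D ↔ ∀ x, x ∈ D ↔ IsDiagonal x ∧ Uncrossed D x := by
  constructor
  · refine fun hD x => ⟨fun hx => ⟨hD.1.1 x hx, fun z hz => hD.1.2 z hz x hx⟩,
      fun ⟨hx, hxD⟩ => hD.mem_of_prop_insert ⟨?_, ?_⟩⟩
    · rintro y (rfl | hy)
      exacts [hx, hD.1.1 y hy]
    · rintro y (rfl | hy) z (rfl | hz)
      exacts [not_crosses_self _, fun h => hxD z hz h.symm, hxD y hy, hD.1.2 y hy z hz]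
  · exact fun hD => ⟨⟨fun x hx => ((hD x).1 hx).1, fun x hx y hy => ((hD y).1 hy).2 x hx⟩,
      fun E hE hDE x hx => (hD x).2 ⟨hE.1 x hx, fun z hz => hE.2 z (hDE hz) x hx⟩⟩

namespace IsTriangulation

variable {D : Set (Sym2 (Vertex n))} {x y : Sym2 (Vertex n)}

theorem mem_iff (hD : IsTriangulation D) : x ∈ D ↔ IsDiagonal x ∧ Uncrossed D x :=
  isTriangulation_iff.1 hD x

theorem uncrossed (hD : IsTriangulation D) (hx : x ∈ D) : Uncrossed D x :=
  (hD.mem_iff.1 hx).2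

theorem not_crosses (hD : IsTriangulation D) (hx : Uncrossed D x) (hy : Uncrossed D y) :
    ¬ Crosses x y :=
  fun h => hy x (hD.mem_iff.2 ⟨h.isDiagonal, hx⟩) h

end IsTriangulation

theorem exists_sbtw_not_isDiagonal {p u q : Vertex n} (hu : sbtw p u q) :
    ∃ v, sbtw p v q ∧ ¬ IsDiagonal s(p, v) := by
  obtain ⟨v, hv⟩ : ∃ v : Vertex n, v.val = p.val + 1 ∨ p.val = 2 * n + 3 ∧ v.val = 0 := by
    obtain hp | hp := lt_or_ge (p.val + 1) (2 * n + 4)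
    · exact ⟨⟨_, hp⟩, Or.inl rfl⟩
    · exact ⟨⟨0, by lia⟩, Or.inr ⟨by lia, rfl⟩⟩
  rw [Fin.sbtw_iff] at hu
  refine ⟨v, Fin.sbtw_iff.2 (by lia), ?_⟩
  rintro ⟨a, b, hab, hlt, hlt'⟩
  obtain ⟨rfl, rfl⟩ | ⟨rfl, rfl⟩ := Sym2.eq_iff.1 hab <;> lia

theorem exists_sbtw_uncrossed_maximal (D : Set (Sym2 (Vertex n))) {p u q : Vertex n}
    (hu : sbtw p u q) :
    ∃ r, sbtw p r q ∧ Uncrossed D s(p, r) ∧ ∀ r', sbtw r r' q → ¬ Uncrossed D s(p, r') := by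
  obtain ⟨v, hv, hpv⟩ := exists_sbtw_not_isDiagonal hu
  obtain ⟨r, ⟨hr, hpr⟩, hmax⟩ :=
    (Set.toFinite {r | sbtw p r q ∧ Uncrossed D s(p, r)}).exists_maximalFor (Set.cIoo p) _
      ⟨v, hv, uncrossed_of_not_isDiagonal D hpv⟩
  refine ⟨r, hr, hpr, fun r' hr' hpr' => ?_⟩
  have hprr' : sbtw p r r' := (sbtw_trans_right hr' hr.cyclic_left).cyclic_right
  have hsubset : Set.cIoo p r ⊆ Set.cIoo p r' := fun w hw => sbtw_trans_right hw hprr'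
  exact sbtw_irrefl_right (Set.mem_cIoo.1 (hmax ⟨hr.trans_left hr', hpr'⟩ hsubset hprr'))

theorem IsTriangulation.exists_triangle {D : Set (Sym2 (Vertex n))} (hD : IsTriangulation D)
    {p u q : Vertex n} (hu : sbtw p u q) (hpq : Uncrossed D s(p, q)) :
    ∃ r, sbtw p r q ∧ Uncrossed D s(p, r) ∧ Uncrossed D s(r, q) := by
  obtain ⟨r, hr, hpr, hmax⟩ := exists_sbtw_uncrossed_maximal D hu
  refine ⟨r, hr, hpr, fun z hz hzrq => ?_⟩
  obtain ⟨e, rfl, he⟩ := hzrq.exists_eq_mk_of_triangle hr (hpq z hz) (hpr z hz)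
  exact hmax e he (hD.uncrossed hz)

/-! ### Central diagonals -/

theorem IsCentral.oppPair_eq {x : Sym2 (Vertex n)} (hx : IsCentral x) : oppPair x = x := by
  obtain ⟨a, rfl⟩ := hx
  rw [oppPair_mk, opp_opp, Sym2.eq_swap]

theorem oppPair_eq_of_mem {v : Vertex n} {x : Sym2 (Vertex n)} (hx : v ∈ x)
    (hx' : v ∈ oppPair x) : oppPair x = x := by
  obtain ⟨w, rfl⟩ := Sym2.mem_iff_exists.1 hx
  obtain hv | hv := Sym2.mem_iff.1 hx'
  · exact absurd hv.symm (opp_ne v)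
  · rw [oppPair_mk, hv, opp_opp, Sym2.eq_swap]

theorem oppPair_mem_pair {x z : Sym2 (Vertex n)} :
    oppPair z ∈ ({x, oppPair x} : Set (Sym2 (Vertex n))) ↔
      z ∈ ({x, oppPair x} : Set (Sym2 (Vertex n))) := by
  have oppPair_mem : ∀ {z}, z ∈ ({x, oppPair x} : Set (Sym2 (Vertex n))) →
      oppPair z ∈ ({x, oppPair x} : Set (Sym2 (Vertex n))) := by
    rintro z (rfl | rfl)
    exacts [Or.inr rfl, Or.inl (oppPair_oppPair x)]
  exact ⟨fun h => oppPair_oppPair z ▸ oppPair_mem h, oppPair_mem⟩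

theorem oppPair_eq_self_iff {x : Sym2 (Vertex n)} : oppPair x = x ↔ IsCentral x := by
  refine ⟨fun h => ?_, IsCentral.oppPair_eq⟩
  induction x with | _ a b =>
  obtain ⟨ha, -⟩ | ⟨-, rfl⟩ := Sym2.eq_iff.1 h
  · exact absurd ha (opp_ne a)
  · exact ⟨b, Sym2.eq_swap⟩

theorem isDiagonal_mk_opp (a : Vertex n) : IsDiagonal s(a, opp a) := by
  obtain ⟨-, ha⟩ | ⟨-, ha⟩ := opp_cases a
  · exact ⟨a, opp a, rfl, by lia, by lia⟩
  · exact ⟨opp a, a, Sym2.eq_swap, by lia, by lia⟩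

theorem isCentral_oppPair {x : Sym2 (Vertex n)} : IsCentral (oppPair x) ↔ IsCentral x := by
  rw [← oppPair_eq_self_iff, ← oppPair_eq_self_iff, oppPair_oppPair, eq_comm]

theorem IsCentral.eq_of_not_crosses {x y : Sym2 (Vertex n)} (hx : IsCentral x) (hy : IsCentral y)
    (hxy : ¬ Crosses x y) : x = y := by
  obtain ⟨a, rfl⟩ := hx
  obtain ⟨b, rfl⟩ := hy
  by_contra hab
  have hab' : ¬ (a = b ∨ opp b = a) := by
    rintro (rfl | rfl)
    · exact hab rfl
    · exact hab (by rw [opp_opp, Sym2.eq_swap])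
  have ha := opp_cases a
  have hb := opp_cases b
  obtain h | h : sbtw b a (opp b) ∨ sbtw (opp b) a b := by
    simp only [Fin.sbtw_iff]
    lia
  · exact hxy (crosses_of_sbtw h (by simpa only [opp_opp] using sbtw_opp h))
  · have h' := sbtw_opp h
    rw [opp_opp] at h'
    rw [Sym2.eq_swap] at hxy
    exact hxy (crosses_of_sbtw h' h)

theorem uncrossed_oppPair {D : Set (Sym2 (Vertex n))} (hD : ∀ z ∈ D, oppPair z ∈ D)
    {x : Sym2 (Vertex n)} (hx : Uncrossed D x) : Uncrossed D (oppPair x) :=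
  fun z hz h => hx _ (hD z hz) (by rwa [← crosses_oppPair, oppPair_oppPair])

namespace SymTriangulation

variable (t : SymTriangulation n) {x : Sym2 (Vertex n)}

theorem oppPair_mem_iff : oppPair x ∈ t.diagonals ↔ x ∈ t.diagonals :=
  ⟨fun h => oppPair_oppPair x ▸ t.symmetric _ h, t.symmetric x⟩

theorem exists_isCentral : ∃ x ∈ t.diagonals, IsCentral x := by
  -- Among the uncrossed chords having the center on them or on a fixed side, take a minimal one. If
  -- the center is not on it, it lies inside the triangle on that side, which then crosses its
  -- opposite.
  let S : Set (Vertex n × Vertex n) :=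
    {e | Uncrossed t.diagonals s(e.1, e.2) ∧ (e.2 = opp e.1 ∨ sbtw e.1 (opp e.1) e.2)}
  have hS : S.Nonempty := by
    refine ⟨(⟨1, by lia⟩, ⟨0, by lia⟩), uncrossed_of_not_isDiagonal _ ?_, Or.inr ?_⟩
    · rintro ⟨a, b, hab, hlt, hlt'⟩
      obtain ⟨rfl, rfl⟩ | ⟨rfl, rfl⟩ := Sym2.eq_iff.1 hab <;> simp at hlt hlt'
    · have := opp_cases (n := n) ⟨1, by lia⟩
      simp only [Fin.sbtw_iff, Fin.lt_def]
      lia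
  obtain ⟨⟨p, q⟩, ⟨hpq, hq⟩, hmin⟩ := S.toFinite.exists_minimalFor (fun e => Set.cIoo e.1 e.2) _ hS
  dsimp only at hpq hq hmin
  obtain rfl | hq := hq
  · exact ⟨_, t.isTriangulation.mem_iff.2 ⟨isDiagonal_mk_opp p, hpq⟩, p, rfl⟩
  obtain ⟨r, hr, hpr, hrq⟩ := t.isTriangulation.exists_triangle hq hpq
  have hr₁ : ¬ (r = opp p ∨ sbtw p (opp p) r) := fun h =>
    sbtw_irrefl_right <| Set.mem_cIoo.1 <|
      hmin (j := (p, r)) ⟨hpr, h⟩ (fun w hw => sbtw_trans_right hw hr) hr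
  have hr₂ : ¬ (q = opp r ∨ sbtw r (opp r) q) := fun h =>
    sbtw_irrefl_left <| Set.mem_cIoo.1 <|
      hmin (j := (r, q)) ⟨hrq, h⟩ (fun w hw => hr.trans_left hw) hr
  refine absurd ?_ (t.isTriangulation.not_crosses (uncrossed_oppPair t.symmetric hpr) hrq)
  have := opp_cases p
  have := opp_cases r
  simp only [Fin.sbtw_iff] at hr hr₁ hr₂ hq
  exact crosses_of_sbtw (Fin.sbtw_iff.2 (by lia)) (Fin.sbtw_iff.2 (by lia))

theorem eq_of_isCentral {t : SymTriangulation n} {x y : Sym2 (Vertex n)} (hx : x ∈ t.diagonals)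
    (hy : y ∈ t.diagonals) (hx' : IsCentral x) (hy' : IsCentral y) : x = y :=
  hx'.eq_of_not_crosses hy' (t.isTriangulation.uncrossed hy x hx)

end SymTriangulation

/-! ### The number of diagonals -/

/-- The vertex `r` is the apex of the triangle of `D` that has base `x` and lies on the side of `x`
away from the side of the polygon joining the last vertex to the first. -/
def IsApex (D : Set (Sym2 (Vertex n))) (x : Sym2 (Vertex n)) (r : Vertex n) : Prop :=
  ∃ p q, x = s(p, q) ∧ p < r ∧ r < q ∧
    Uncrossed D s(p, q) ∧ Uncrossed D s(p, r) ∧ Uncrossed D s(r, q)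

namespace IsTriangulation

variable {D : Set (Sym2 (Vertex n))} {p q r : Vertex n} {x y : Sym2 (Vertex n)}

theorem exists_isApex (hD : IsTriangulation D) (hpq : p.val + 1 < q.val)
    (hx : Uncrossed D s(p, q)) : ∃ r, IsApex D s(p, q) r := by
  have hu : sbtw p ⟨p.val + 1, by lia⟩ q := by
    simp only [Fin.sbtw_iff, Fin.lt_def]
    lia
  obtain ⟨r, hr, hpr, hrq⟩ := hD.exists_triangle hu hx
  rw [Fin.sbtw_iff] at hr
  exact ⟨r, p, q, rfl, by lia, by lia, hx, hpr, hrq⟩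

theorem eq_of_isApex (hD : IsTriangulation D) (hx : IsApex D x r) (hy : IsApex D y r) : x = y := by
  obtain ⟨p, q, rfl, hpr, hrq, hpq, hpr', hrq'⟩ := hx
  obtain ⟨e, f, rfl, her, hrf, hef, her', hrf'⟩ := hy
  obtain rfl : p = e := by
    refine le_antisymm (le_of_not_gt fun hep => ?_) (le_of_not_gt fun hpe => ?_)
    · exact hD.not_crosses her' hpq ⟨e, r, p, q, hep, hpr, hrq, Or.inl ⟨rfl, rfl⟩⟩
    · exact hD.not_crosses hpr' hef ⟨p, r, e, f, hpe, her, hrf, Or.inl ⟨rfl, rfl⟩⟩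
  obtain rfl : q = f := by
    refine le_antisymm (le_of_not_gt fun hfq => ?_) (le_of_not_gt fun hqf => ?_)
    · exact hD.not_crosses hef hrq' ⟨p, f, r, q, hpr, hrf, hfq, Or.inl ⟨rfl, rfl⟩⟩
    · exact hD.not_crosses hpq hrf' ⟨p, q, r, f, hpr, hrq, hqf, Or.inl ⟨rfl, rfl⟩⟩
  rfl

theorem ncard_le (hD : IsTriangulation D) : D.ncard ≤ 2 * n + 1 := by
  have htop : (⊤ : Vertex n).val = 2 * n + 3 :=
    le_antisymm (by lia) (Fin.le_def.1 (le_top (a := (⟨2 * n + 3, by lia⟩ : Vertex n))))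
  have hbot : (⊥ : Vertex n).val = 0 := rfl
  have hside : ¬ IsDiagonal s((⊥ : Vertex n), ⊤) := by
    rintro ⟨a, b, hab, hlt, hlt'⟩
    obtain ⟨rfl, rfl⟩ | ⟨rfl, rfl⟩ := Sym2.eq_iff.1 hab <;> lia
  have hapex : ∀ x ∈ insert s(⊥, ⊤) D, ∃ r, IsApex D x r := by
    rintro x (rfl | hx)
    · exact hD.exists_isApex (by lia) (uncrossed_of_not_isDiagonal D hside)
    · obtain ⟨⟨p, q, rfl, hpq, -⟩, hx⟩ := hD.mem_iff.1 hx
      exact hD.exists_isApex hpq hx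
  choose! apex hapex using hapex
  have hmaps : Set.MapsTo apex (insert s(⊥, ⊤) D) {⊥, ⊤}ᶜ := by
    rintro x hx
    obtain ⟨p, q, -, hpr, hrq, -⟩ := hapex x hx
    rintro (h | h)
    exacts [hpr.ne_bot h, hrq.ne_top h]
  have hinj : Set.InjOn apex (insert s(⊥, ⊤) D) := fun x hx y hy hxy =>
    hD.eq_of_isApex (hapex x hx) (hxy ▸ hapex y hy)
  have hle := Set.ncard_le_ncard_of_injOn apex hmaps hinj
  rw [Set.ncard_insert_of_notMem fun h => hside (hD.mem_iff.1 h).1] at hle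
  have hcard := Set.ncard_add_ncard_compl ({⊥, ⊤} : Set (Vertex n))
  rw [Set.ncard_pair bot_ne_top, Nat.card_fin] at hcard
  lia

end IsTriangulation

/-! ### Flips -/

namespace SymTriangulation

variable {t : SymTriangulation n}

theorem exists_isFlip_of_exchange {x y : Sym2 (Vertex n)} (hx : x ∈ t.diagonals)
    (hxy : Crosses x y) (hy : Uncrossed (t.diagonals \ {x}) y)
    (huniq : ∀ w, Crosses w x → Uncrossed (t.diagonals \ {x, oppPair x}) w → w = y) :
    ∃ t', IsFlip t t' x y := by
  have hyt : y ∉ t.diagonals := fun h => t.isTriangulation.uncrossed h x hx hxy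
  let E := t.diagonals \ {x, oppPair x} ∪ {y, oppPair y}
  have hsymm : ∀ z ∈ E, oppPair z ∈ E := fun z hz => by
    simpa only [E, Set.mem_union, Set.mem_sdiff, oppPair_mem_pair, t.oppPair_mem_iff] using hz
  have hyE : Uncrossed E y := by
    rintro z (⟨hz, hzx⟩ | rfl | rfl)
    exacts [hy z ⟨hz, fun h => hzx (Or.inl h)⟩, not_crosses_self _, not_crosses_oppPair _]
  have hwy : ∀ w, Crosses w x → Uncrossed E w → w = y := fun w hw hwE =>
    huniq w hw fun z hz => hwE z (Or.inl hz)
  refine ⟨⟨E, isTriangulation_iff.2 fun w => ⟨?_, fun ⟨hw, hwE⟩ => ?_⟩, hsymm⟩, hx, hyt, rfl⟩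
  · rintro (hw | rfl | rfl)
    · refine ⟨(t.isTriangulation.mem_iff.1 hw.1).1, ?_⟩
      rintro z (hz | rfl | rfl)
      · exact t.isTriangulation.uncrossed hw.1 z hz.1
      · exact fun h => hyE w (Or.inl hw) h.symm
      · exact fun h => uncrossed_oppPair hsymm hyE w (Or.inl hw) h.symm
    · exact ⟨hxy.symm.isDiagonal, hyE⟩
    · exact ⟨isDiagonal_oppPair.2 hxy.symm.isDiagonal, uncrossed_oppPair hsymm hyE⟩
  · by_cases hwx : Crosses w x
    · exact Or.inr (Or.inl (hwy w hwx hwE))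
    by_cases hwx' : Crosses w (oppPair x)
    · rw [← crosses_oppPair, oppPair_oppPair] at hwx'
      have hwy' := hwy _ hwx' (uncrossed_oppPair hsymm hwE)
      exact Or.inr (Or.inr (by rw [← hwy', oppPair_oppPair, Set.mem_singleton_iff]))
    have hwt : w ∈ t.diagonals := t.isTriangulation.mem_iff.2 ⟨hw, fun z hz hzw => by
      by_cases hzx : z ∈ ({x, oppPair x} : Set _)
      · obtain rfl | rfl := hzx
        exacts [hwx hzw.symm, hwx' hzw.symm]
      · exact hwE z (Or.inl ⟨hz, hzx⟩) hzw⟩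
    refine Or.inl ⟨hwt, ?_⟩
    rintro (rfl | rfl)
    · exact hwE y (Or.inr (Or.inl rfl)) hxy.symm
    · exact hwE _ (Or.inr (Or.inr rfl)) (crosses_oppPair.2 hxy.symm)

theorem exists_isFlip_of_quadrilateral {a p q r : Vertex n} (hr : sbtw p r q) (ha : sbtw q a p)
    (hpq : s(p, q) ∈ t.diagonals) (hpr : Uncrossed t.diagonals s(p, r))
    (hrq : Uncrossed t.diagonals s(r, q)) (hqa : Uncrossed t.diagonals s(q, a))
    (hap : Uncrossed t.diagonals s(a, p)) : ∃ t', IsFlip t t' s(p, q) s(a, r) := by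
  have hxy : Crosses s(p, q) s(a, r) := by
    rw [Sym2.eq_swap (a := a)]
    exact (crosses_of_sbtw hr ha).symm
  have hr' : r ∉ s(p, q) := fun h => not_crosses_of_mem h (Sym2.mem_mk_right a r) hxy
  have ha' : a ∉ s(p, q) := fun h => not_crosses_of_mem h (Sym2.mem_mk_left a r) hxy
  refine exists_isFlip_of_exchange hpq hxy (fun z ⟨hz, hzx⟩ hzar => hzx ?_) fun w hw hwt => ?_
  · have hp : sbtw a p r := (sbtw_trans_right hr ha.cyclic_right).cyclic_right
    have hq : sbtw r q a := (sbtw_trans_right ha hr.cyclic_right).cyclic_right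
    exact (hzar.eq_mk_of_quadrilateral hp hq (hqa z hz) (hap z hz) (hpr z hz) (hrq z hz)).trans
      Sym2.eq_swap
  have hside : ∀ u v, u ∉ s(p, q) → v ∈ s(p, q) → Uncrossed t.diagonals s(u, v) →
      ¬ Crosses w s(u, v) := by
    intro u v hu hv huv hwuv
    refine hwt _ ⟨t.isTriangulation.mem_iff.2 ⟨hwuv.symm.isDiagonal, huv⟩, ?_⟩ hwuv.symm
    rintro (h | h)
    · exact hu (h ▸ Sym2.mem_mk_left u v)
    · rw [oppPair_eq_of_mem hv (h ▸ Sym2.mem_mk_right u v)] at h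
      exact hu (h ▸ Sym2.mem_mk_left u v)
  rw [Sym2.eq_swap] at hpr hqa
  refine hw.eq_mk_of_quadrilateral hr ha (hside a p ha' (Sym2.mem_mk_left p q) hap) ?_
    (hside r q hr' (Sym2.mem_mk_right p q) hrq) ?_
  · rw [Sym2.eq_swap]
    exact hside r p hr' (Sym2.mem_mk_left p q) hpr
  · rw [Sym2.eq_swap]
    exact hside a q ha' (Sym2.mem_mk_right p q) hqa

theorem exists_isFlip_of_notMem {a b : Vertex n} (hab : IsDiagonal s(a, b))
    (habt : s(a, b) ∉ t.diagonals) :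
    ∃ t' x r, IsFlip t t' x s(a, r) ∧ Crosses x s(a, b) := by
  -- Flip the side `s(p, q)` of the triangle `a p q` into which `s(a, b)` enters at `a`.
  obtain ⟨y, hy⟩ := isDiagonal_iff_exists_crosses.1 hab
  obtain ⟨u, -, -, hu, -⟩ := crosses_mk_right.1 hy.symm
  obtain ⟨p, hp, hap, hmax⟩ := exists_sbtw_uncrossed_maximal t.diagonals hu
  rw [Sym2.eq_swap] at hap
  obtain ⟨q, hq, hpq, hqa⟩ := t.isTriangulation.exists_triangle hp.cyclic_left hap
  have hqb : q ≠ b := by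
    rintro rfl
    rw [Sym2.eq_swap] at hqa
    exact habt (t.isTriangulation.mem_iff.2 ⟨hab, hqa⟩)
  have hbqa : sbtw b q a := (sbtw_or_sbtw_of_ne hq hqb.symm).resolve_left fun h =>
    hmax q h (by rwa [Sym2.eq_swap])
  have hcross : Crosses s(p, q) s(a, b) := crosses_of_sbtw hp hbqa
  obtain ⟨r, hr, hpr, hrq⟩ :=
    t.isTriangulation.exists_triangle
      (sbtw_trans_right hbqa hp.cyclic_right).cyclic_right hpq
  obtain ⟨t', ht'⟩ := exists_isFlip_of_quadrilateral hr hq.cyclic_left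
    (t.isTriangulation.mem_iff.2 ⟨hcross.isDiagonal, hpq⟩) hpr hrq hqa (by rwa [Sym2.eq_swap])
  exact ⟨t', _, r, ht', hcross⟩

end SymTriangulation

/-! ### Connectivity of the flip graph -/

theorem sbtw_or_sbtw_of_separated {α : Type*} [CircularOrder α] {p q a b c d : α}
    (ha : sbtw p a q) (hc : sbtw q c p) (hb : sbtw a c b) (hd : sbtw b d a) :
    sbtw q b p ∨ sbtw p d q := by
  obtain rfl | hbp := eq_or_ne b p
  · exact Or.inr (sbtw_trans_right hd ha)
  have hcpa : sbtw c p a := (sbtw_trans_right ha hc.cyclic_right).cyclic_right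
  obtain hcpb | hbpa := sbtw_or_sbtw_of_ne hcpa hbp
  · have hpba : sbtw p b a := (sbtw_trans_right hb.cyclic_right hcpb.cyclic_right).cyclic_right
    exact Or.inr (sbtw_trans_right (hpba.trans_left hd) ha)
  · have hcbp : sbtw c b p := (sbtw_trans_right hbpa hb.cyclic_right).cyclic_right
    exact Or.inl (hc.trans_left hcbp)

theorem IsCentral.not_crosses_oppPair {z : Sym2 (Vertex n)} {a b r : Vertex n} (hz : IsCentral z)
    (ha : a ∉ z) (hb : ¬ Crosses z s(a, b)) (hr : ¬ Crosses z s(a, r)) :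
    ¬ Crosses (oppPair s(a, r)) s(a, b) := by
  obtain ⟨u, rfl, hu⟩ : ∃ u, z = s(u, opp u) ∧ sbtw u a (opp u) := by
    obtain ⟨u, rfl⟩ := hz
    rw [Sym2.mem_iff, not_or] at ha
    have hu := opp_cases u
    obtain h | h : sbtw u a (opp u) ∨ sbtw (opp u) a u := by
      simp only [Fin.sbtw_iff]
      lia
    · exact ⟨u, rfl, h⟩
    · exact ⟨opp u, by rw [opp_opp, Sym2.eq_swap], by rwa [opp_opp]⟩
  have ha' : sbtw (opp u) (opp a) u := by simpa only [opp_opp] using sbtw_opp hu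
  have hb' : ¬ sbtw (opp u) b u := fun h => hb (crosses_of_sbtw hu h).symm
  have hr' : ¬ sbtw u (opp r) (opp u) := fun h =>
    hr (crosses_of_sbtw hu (by simpa only [opp_opp] using sbtw_opp h)).symm
  intro h
  obtain ⟨c, d, hcd, hc, hd⟩ := crosses_mk_right.1 h
  obtain ⟨rfl, rfl⟩ | ⟨rfl, rfl⟩ := Sym2.eq_iff.1 hcd
  · exact (sbtw_or_sbtw_of_separated hu ha' hc hd).elim hb' hr'
  · exact (sbtw_or_sbtw_of_separated (α := (Vertex n)ᵒᵈ) hu ha' hd hc).elim hb' hr'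

/-- A flip that introduces `s(a, r)` also introduces the opposite edge, which must not create a new
crossing with `y`: this dictates the choice of the end point `a` of `y`. -/
theorem exists_endpoint {D : Set (Sym2 (Vertex n))} {y : Sym2 (Vertex n)} (hy : IsDiagonal y)
    (hyD : y ∉ D) (hyD' : Uncrossed D y) (hc : IsCentral y ∨ ∃ z ∈ D, IsCentral z) :
    ∃ a b, y = s(a, b) ∧ ∀ r, Uncrossed D s(a, r) → ¬ Crosses (oppPair s(a, r)) y := by
  obtain ⟨a, rfl⟩ | ⟨z, hz, hzc⟩ := hc
  · exact ⟨a, opp a, rfl, fun r _ =>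
      not_crosses_of_mem (Sym2.mem_mk_left (opp a) (opp r)) (Sym2.mem_mk_right a (opp a))⟩
  have key : ∀ a b, y = s(a, b) → a ∉ z →
      ∃ a b, y = s(a, b) ∧ ∀ r, Uncrossed D s(a, r) → ¬ Crosses (oppPair s(a, r)) y := by
    rintro a b rfl ha
    exact ⟨a, b, rfl, fun r hr => hzc.not_crosses_oppPair ha (hyD' z hz) (hr z hz)⟩
  induction y with | _ a b =>
  have hab : a ≠ b := by
    rintro rfl
    exact not_isDiagonal_diag a hy
  by_cases ha : a ∈ z
  · refine key b a Sym2.eq_swap fun hb => hyD ?_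
    rwa [← (Sym2.mem_and_mem_iff hab).1 ⟨ha, hb⟩]
  · exact key a b rfl ha

/-- The edges of the flip graph of the triangulations that contain `D`. -/
def FlipStep (D : Set (Sym2 (Vertex n))) (t t' : SymTriangulation n) : Prop :=
  D ⊆ t.diagonals ∧ D ⊆ t'.diagonals ∧ ∃ x y, IsFlip t t' x y

theorem antitone_flipStep : Antitone (FlipStep (n := n)) :=
  fun _ _ hDE _ _ h => ⟨hDE.trans h.1, hDE.trans h.2.1, h.2.2⟩

theorem oppPair_mem_insert {D : Set (Sym2 (Vertex n))} (hD : ∀ x ∈ D, oppPair x ∈ D)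
    (y : Sym2 (Vertex n)) :
    ∀ x ∈ insert y (insert (oppPair y) D), oppPair x ∈ insert y (insert (oppPair y) D) := by
  rintro x (rfl | rfl | hx)
  exacts [Or.inr (Or.inl rfl), Or.inl (oppPair_oppPair y), Or.inr (Or.inr (hD x hx))]

namespace SymTriangulation

variable {D : Set (Sym2 (Vertex n))} {t s : SymTriangulation n} {y : Sym2 (Vertex n)}

theorem exists_flipStep (hD : ∀ x ∈ D, oppPair x ∈ D) (hDt : D ⊆ t.diagonals) (hy : IsDiagonal y)
    (hyD : Uncrossed D y) (hc : IsCentral y ∨ ∃ z ∈ D, IsCentral z) (hyt : y ∉ t.diagonals) :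
    ∃ t', FlipStep D t t' ∧ {x ∈ t'.diagonals | Crosses x y} ⊂ {x ∈ t.diagonals | Crosses x y} := by
  obtain ⟨a, b, rfl, hopp⟩ := exists_endpoint hy (fun h => hyt (hDt h)) hyD hc
  obtain ⟨t', x, r, hflip, hxy⟩ := exists_isFlip_of_notMem hy hyt
  have hxD : x ∉ D := fun h => hyD x h hxy
  have hDt' : D ⊆ t'.diagonals := by
    intro z hz
    rw [hflip.2.2]
    refine Or.inl ⟨hDt hz, ?_⟩
    rintro (rfl | rfl)
    · exact hxD hz
    · exact hxD (by simpa only [oppPair_oppPair] using hD _ hz)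
  have har : Uncrossed D s(a, r) := fun z hz =>
    t'.isTriangulation.uncrossed hflip.symm.1 z (hDt' hz)
  refine ⟨t', ⟨hDt, hDt', x, _, hflip⟩, fun z ⟨hz, hzy⟩ => ?_, fun h => ?_⟩
  · rw [hflip.2.2] at hz
    obtain ⟨hz, -⟩ | rfl | rfl := hz
    · exact ⟨hz, hzy⟩
    · exact absurd hzy (not_crosses_of_mem (Sym2.mem_mk_left a r) (Sym2.mem_mk_left a b))
    · exact absurd hzy (hopp r har)
  · exact hflip.symm.2.1 (h ⟨hflip.1, hxy⟩).1

theorem insert_oppPair_subset (hy : y ∈ t.diagonals) (hDt : D ⊆ t.diagonals) :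
    insert y (insert (oppPair y) D) ⊆ t.diagonals :=
  Set.insert_subset hy (Set.insert_subset (t.symmetric y hy) hDt)

theorem exists_reflTransGen_flipStep (hD : ∀ x ∈ D, oppPair x ∈ D) (hDt : D ⊆ t.diagonals)
    (hy : IsDiagonal y) (hyD : Uncrossed D y) (hc : IsCentral y ∨ ∃ z ∈ D, IsCentral z) :
    ∃ t', Relation.ReflTransGen (FlipStep D) t t' ∧
      insert y (insert (oppPair y) D) ⊆ t'.diagonals := by
  induction h : {x ∈ t.diagonals | Crosses x y} using WellFoundedLT.induction generalizing t with
  | ind _ ih =>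
    by_cases hyt : y ∈ t.diagonals
    · exact ⟨t, .refl, insert_oppPair_subset hyt hDt⟩
    · obtain ⟨t', htt', hlt⟩ := exists_flipStep hD hDt hy hyD hc hyt
      obtain ⟨t'', ht', hyt''⟩ := ih _ (h ▸ hlt) htt'.2.1 rfl
      exact ⟨t'', .head htt' ht', hyt''⟩

theorem eq_of_subset (h : t.diagonals ⊆ s.diagonals) : t = s :=
  SymTriangulation.ext (t.isTriangulation.eq_of_subset s.isTriangulation.1 h)

theorem reflTransGen_flipStep_of_isCentral {z : Sym2 (Vertex n)} (hz : z ∈ D) (hzc : IsCentral z)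
    (hD : ∀ x ∈ D, oppPair x ∈ D) (hDt : D ⊆ t.diagonals) (hDs : D ⊆ s.diagonals) :
    Relation.ReflTransGen (FlipStep D) t s := by
  induction D using WellFoundedGT.induction generalizing t with | ind D ih =>
  obtain hsD | hsD := em (s.diagonals ⊆ D)
  · rw [eq_of_subset (hsD.trans hDt)]
  obtain ⟨y, hys, hyD⟩ := Set.not_subset.1 hsD
  obtain ⟨t', htt', ht'⟩ := exists_reflTransGen_flipStep hD hDt (s.isTriangulation.mem_iff.1 hys).1
    (fun w hw => s.isTriangulation.uncrossed hys w (hDs hw)) (Or.inr ⟨z, hz, hzc⟩)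
  have hDE : D ⊂ insert y (insert (oppPair y) D) :=
    ⟨fun x hx => Or.inr (Or.inr hx), fun h => hyD (h (Or.inl rfl))⟩
  exact htt'.trans <| Relation.ReflTransGen.mono (antitone_flipStep hDE.1) _ _ <|
    ih _ hDE (hDE.1 hz) (oppPair_mem_insert hD y) ht' (insert_oppPair_subset hys hDs)

theorem reflTransGen_flipStep (hD : ∀ x ∈ D, oppPair x ∈ D) (hDt : D ⊆ t.diagonals)
    (hDs : D ⊆ s.diagonals) : Relation.ReflTransGen (FlipStep D) t s := by
  obtain ⟨z, hz, hzc⟩ := s.exists_isCentral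
  obtain ⟨t', htt', ht'⟩ := exists_reflTransGen_flipStep hD hDt (s.isTriangulation.mem_iff.1 hz).1
    (fun w hw => s.isTriangulation.uncrossed hz w (hDs hw)) (Or.inl hzc)
  have hDE : D ⊆ insert z (insert (oppPair z) D) := fun x hx => Or.inr (Or.inr hx)
  exact htt'.trans <| Relation.ReflTransGen.mono (antitone_flipStep hDE) _ _ <|
    reflTransGen_flipStep_of_isCentral (Or.inl rfl) hzc (oppPair_mem_insert hD z) ht'
      (insert_oppPair_subset hz hDs)

end SymTriangulation

/-! ### Colorings -/

theorem mk_eq_mk_iff_of_involutive {α : Type*} {f : α → α} (hf : Function.Involutive f) {x y : α} :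
    s(x, f x) = s(y, f y) ↔ y = x ∨ y = f x := by
  rw [Sym2.eq_iff]
  refine ⟨fun h => h.imp (fun h => h.1.symm) fun h => h.2.symm, ?_⟩
  rintro (rfl | rfl)
  · exact Or.inl ⟨rfl, rfl⟩
  · exact Or.inr ⟨(hf x).symm, rfl⟩

theorem card_image_mk_mul_two_le {α : Type*} [DecidableEq α] {f : α → α}
    (hf : Function.Involutive f) {A : Finset α} (hA : ∀ x ∈ A, f x ∈ A) (hne : ∀ x ∈ A, f x ≠ x) :
    (A.image fun x => s(x, f x)).card * 2 ≤ A.card := by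
  rw [Finset.card_eq_sum_card_image (fun x => s(x, f x)) A, ← smul_eq_mul]
  refine Finset.card_nsmul_le_sum _ _ 2 fun p hp => ?_
  obtain ⟨x, hx, rfl⟩ := Finset.mem_image.1 hp
  refine (Finset.card_pair (hne x hx).symm).ge.trans (Finset.card_le_card fun y hy => ?_)
  rw [Finset.mem_insert, Finset.mem_singleton] at hy
  rw [Finset.mem_filter, eq_comm, mk_eq_mk_iff_of_involutive hf]
  refine ⟨?_, hy⟩
  rcases hy with rfl | rfl
  exacts [hx, hA x hx]

theorem SymTriangulation.exists_coloring (t : SymTriangulation n) :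
    ∃ T : ColoredTriangulation n, T.supp = t := by
  classical
  let A : Finset (Sym2 (Vertex n)) := {x | x ∈ t.diagonals ∧ ¬ IsCentral x}
  have mem_A {x} : x ∈ A ↔ x ∈ t.diagonals ∧ ¬ IsCentral x := by simp [A]
  have hpairs : (A.image fun x => s(x, oppPair x)).card * 2 ≤ A.card := by
    refine card_image_mk_mul_two_le oppPair_oppPair (fun x hx => ?_) fun x hx h => ?_
    · rwa [mem_A, t.oppPair_mem_iff, isCentral_oppPair, ← mem_A]
    · exact (mem_A.1 hx).2 (oppPair_eq_self_iff.1 h)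
  have hA : A.card ≤ 2 * n + 1 := by
    rw [← Set.ncard_coe_finset]
    exact (Set.ncard_le_ncard fun x hx => (mem_A.1 hx).1).trans t.isTriangulation.ncard_le
  obtain ⟨e⟩ : Nonempty (A.image (fun x => s(x, oppPair x)) ↪ Fin n) :=
    Function.Embedding.nonempty_of_card_le (by rw [Fintype.card_coe, Fintype.card_fin]; lia)
  refine ⟨⟨t, fun x => if h : x ∈ A then some (e ⟨_, Finset.mem_image_of_mem _ h⟩) else none,
    fun x => ?_, fun x hx y hy hxc hyc => ?_⟩, rfl⟩
  · rw [← mem_A]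
    split_ifs with h <;> simp [h]
  · rw [dif_pos (mem_A.2 ⟨hx, hxc⟩), dif_pos (mem_A.2 ⟨hy, hyc⟩), Option.some_inj,
      e.injective.eq_iff, Subtype.mk_eq_mk, mk_eq_mk_iff_of_involutive oppPair_oppPair]

theorem exists_perm_comp_eq {α β : Type*} [Finite β] {f g : α → β}
    (h : ∀ x y, f x = f y ↔ g x = g y) : ∃ σ : Equiv.Perm β, ∀ x, σ (f x) = g x := by
  classical
  have := Fintype.ofFinite β
  let e : Set.range f ≃ Set.range g := (Setoid.quotientKerEquivRange f).symm.trans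
    ((Quotient.congrRight h).trans (Setoid.quotientKerEquivRange g))
  refine ⟨e.extendSubtype, fun x => ?_⟩
  rw [Equiv.extendSubtype_apply_of_mem e _ (Set.mem_range_self x)]
  have : (Setoid.quotientKerEquivRange f).symm ⟨f x, Set.mem_range_self x⟩ = Quotient.mk _ x :=
    (Equiv.symm_apply_eq _).2 rfl
  simp only [e, Equiv.trans_apply]
  rw [this]
  rfl

namespace ColoredTriangulation

variable {T S : ColoredTriangulation n} {x y : Sym2 (Vertex n)}

theorem color_eq_none_iff : T.color x = none ↔ (x ∈ T.supp.diagonals → IsCentral x) := by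
  rw [← Option.not_isSome_iff_eq_none, T.isSome_color_iff, not_and_not_right]

theorem color_oppPair (hx : x ∈ T.supp.diagonals) : T.color (oppPair x) = T.color x := by
  by_cases h : IsCentral x
  · rw [h.oppPair_eq]
  · exact ((T.color_eq_iff x hx _ (T.supp.symmetric x hx) h (by rwa [isCentral_oppPair])).2
      (Or.inr rfl)).symm

theorem eq_or_eq_oppPair_of_color_eq (hx : x ∈ T.supp.diagonals) (hy : y ∈ T.supp.diagonals)
    (h : T.color x = T.color y) : y = x ∨ y = oppPair x := by
  have central_iff : IsCentral x ↔ IsCentral y := by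
    simpa [color_eq_none_iff, hx, hy] using congrArg (· = none) h
  by_cases hxc : IsCentral x
  · exact Or.inl (SymTriangulation.eq_of_isCentral hy hx (central_iff.1 hxc) hxc)
  · exact (T.color_eq_iff x hx y hy hxc (central_iff.not.1 hxc)).1 h

theorem color_eq_color_iff_of_supp_eq (h : T.supp = S.supp) (x y : Sym2 (Vertex n)) :
    T.color x = T.color y ↔ S.color x = S.color y := by
  have none_iff (z : Sym2 (Vertex n)) : T.color z = none ↔ S.color z = none := by
    rw [color_eq_none_iff, color_eq_none_iff, h]
  by_cases hx : T.color x = none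
  · rw [hx, (none_iff x).1 hx, eq_comm, none_iff, eq_comm]
  by_cases hy : T.color y = none
  · rw [hy, (none_iff y).1 hy, none_iff]
  simp only [color_eq_none_iff, Classical.not_imp] at hx hy
  rw [T.color_eq_iff x hx.1 y hy.1 hx.2 hy.2]
  rw [h] at hx hy
  rw [S.color_eq_iff x hx.1 y hy.1 hx.2 hy.2]

theorem exists_smul_eq (h : T.supp = S.supp) : ∃ σ : Equiv.Perm (Fin n), σ • T = S := by
  obtain ⟨σ, hσ⟩ := exists_perm_comp_eq (color_eq_color_iff_of_supp_eq h)
  have hσ_none : σ none = none := by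
    obtain ⟨d, -, hd⟩ := T.supp.exists_isCentral
    have color_d (R : ColoredTriangulation n) : R.color d = none := color_eq_none_iff.2 fun _ => hd
    rw [← color_d T, hσ, color_d S, color_d T]
  refine ⟨Equiv.removeNone σ, ColoredTriangulation.ext h (funext fun x => ?_)⟩
  change (T.color x).map (Equiv.removeNone σ) = S.color x
  rw [← hσ x]
  cases T.color x with
  | none => exact hσ_none.symm
  | some c =>
    refine Equiv.removeNone_some σ (Option.ne_none_iff_exists'.1 fun hc => ?_)
    exact Option.some_ne_none c (σ.injective (hc.trans hσ_none.symm))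

end ColoredTriangulation

section Exchange

open Classical in
/-- The exchange of `x` with `y` and of the opposite of `x` with the opposite of `y`: it identifies
the diagonals of two triangulations that differ by a flip of `x` into `y`. -/
noncomputable def exchange (x y z : Sym2 (Vertex n)) : Sym2 (Vertex n) :=
  if z = x then y else if z = oppPair x then oppPair y else
    if z = y then x else if z = oppPair y then oppPair x else z

variable {t t' : SymTriangulation n} {x y z : Sym2 (Vertex n)}

theorem IsFlip.isCentral_of_isCentral (h : IsFlip t t' x y) (hx : IsCentral x) : IsCentral y := by
  obtain ⟨w, hw, hwc⟩ := t'.exists_isCentral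
  rw [h.2.2] at hw
  rcases hw with ⟨hw, hw'⟩ | rfl | rfl
  · exact absurd (Or.inl (SymTriangulation.eq_of_isCentral hw h.1 hwc hx)) hw'
  · exact hwc
  · exact isCentral_oppPair.1 hwc

theorem IsFlip.isCentral_iff (h : IsFlip t t' x y) : IsCentral x ↔ IsCentral y :=
  ⟨h.isCentral_of_isCentral, h.symm.isCentral_of_isCentral⟩

theorem IsFlip.oppPair_eq_iff (h : IsFlip t t' x y) : oppPair x = x ↔ oppPair y = y := by
  rw [oppPair_eq_self_iff, oppPair_eq_self_iff, h.isCentral_iff]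

theorem IsFlip.oppPair_ne (h : IsFlip t t' x y) : oppPair x ≠ y := fun e =>
  h.2.1 (e ▸ t.symmetric x h.1)

theorem IsFlip.exchange_oppPair (h : IsFlip t t' x y) (z : Sym2 (Vertex n)) :
    exchange x y (oppPair z) = oppPair (exchange x y z) := by
  have := h.oppPair_eq_iff
  have := h.oppPair_ne
  grind [exchange, oppPair_oppPair, IsFlip]

theorem IsFlip.exchange_injective (h : IsFlip t t' x y) : Function.Injective (exchange x y) := by
  have involutive : Function.Involutive (exchange x y) := fun z => by
    have := h.oppPair_eq_iff
    have := h.oppPair_ne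
    grind [exchange, oppPair_oppPair, IsFlip]
  exact involutive.injective

theorem IsFlip.exchange_mem_iff (h : IsFlip t t' x y) :
    exchange x y z ∈ t.diagonals ↔ z ∈ t'.diagonals := by
  have oppPair_mem_iff (w) : oppPair w ∈ t.diagonals ↔ w ∈ t.diagonals := t.oppPair_mem_iff
  have := h.oppPair_ne
  have := h.oppPair_eq_iff
  rw [h.2.2]
  grind [exchange, oppPair_oppPair, IsFlip]

theorem IsFlip.isCentral_exchange (h : IsFlip t t' x y) :
    IsCentral (exchange x y z) ↔ IsCentral z := by
  have := h.isCentral_iff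
  grind [exchange, isCentral_oppPair]

theorem IsFlip.exchange_eq_self (h : IsFlip t t' x y) (hz : z ∈ t.diagonals)
    (hz' : z ∈ t'.diagonals) : exchange x y z = z := by
  have := t.oppPair_mem_iff (x := y)
  have := t'.oppPair_mem_iff (x := x)
  have := h.symm
  grind [exchange, IsFlip]

theorem IsFlip.exchange_right (h : IsFlip t t' x y) : exchange x y y = x := by
  have := h.oppPair_ne
  grind [exchange, IsFlip]

theorem ColoredTriangulation.exists_isColoredFlip (T : ColoredTriangulation n)
    (h : IsFlip T.supp t' x y) :
    ∃ T' : ColoredTriangulation n, T'.supp = t' ∧ IsColoredFlip (T.color x) T T' := by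
  refine ⟨⟨t', fun z => T.color (exchange x y z), fun z => ?_, fun z hz w hw hzc hwc => ?_⟩, rfl,
    x, y, h, rfl, congrArg T.color h.exchange_right,
    fun z hz hz' => congrArg T.color (h.exchange_eq_self hz hz')⟩
  · rw [T.isSome_color_iff, h.exchange_mem_iff, h.isCentral_exchange]
  · rw [T.color_eq_iff _ (h.exchange_mem_iff.2 hz) _ (h.exchange_mem_iff.2 hw)
      (h.isCentral_exchange.not.2 hzc) (h.isCentral_exchange.not.2 hwc), ← h.exchange_oppPair,
      h.exchange_injective.eq_iff, h.exchange_injective.eq_iff]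

end Exchange

/-! ### Forgetting the colors of a face -/

section FaceVertices

variable {C C' : Set (Option (Fin n))} {c : Option (Fin n)} {T S : ColoredTriangulation n}

/-- The diagonals of `T` that flips of colors in `C` never move. -/
def fixedDiagonals (C : Set (Option (Fin n))) (T : ColoredTriangulation n) :
    Set (Sym2 (Vertex n)) :=
  {x ∈ T.supp.diagonals | T.color x ∉ C}

theorem oppPair_mem_fixedDiagonals {x : Sym2 (Vertex n)} (hx : x ∈ fixedDiagonals C T) :
    oppPair x ∈ fixedDiagonals C T :=
  ⟨T.supp.symmetric x hx.1, by rw [ColoredTriangulation.color_oppPair hx.1]; exact hx.2⟩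

theorem IsColoredFlip.fixedDiagonals_subset (h : IsColoredFlip c T S) (hc : c ∈ C) :
    fixedDiagonals C T ⊆ fixedDiagonals C S := by
  obtain ⟨x, y, hflip, rfl, -, hkeep⟩ := h
  rintro z ⟨hz, hzC⟩
  have hzS : z ∈ S.supp.diagonals := by
    rw [hflip.2.2]
    refine Or.inl ⟨hz, ?_⟩
    rintro (rfl | rfl)
    · exact hzC hc
    · exact hzC (by rwa [ColoredTriangulation.color_oppPair hflip.1])
  exact ⟨hzS, by rwa [hkeep z hz hzS]⟩

theorem faceVertices_eq_of_mem (h : S ∈ faceVertices C T) :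
    faceVertices C S = faceVertices C T :=
  Set.ext fun _ => ⟨SimpleGraph.Reachable.trans h, (SimpleGraph.Reachable.symm h).trans⟩

theorem self_mem_faceVertices : T ∈ faceVertices C T :=
  SimpleGraph.Reachable.refl _

theorem mem_faceVertices_of_isColoredFlip {R : ColoredTriangulation n}
    (hR : R ∈ faceVertices C T) (hc : c ∈ C) (h : IsColoredFlip c R S) : S ∈ faceVertices C T :=
  SimpleGraph.Reachable.trans hR (SimpleGraph.Adj.reachable ⟨c, hc, h⟩)

theorem faceVertices_induction {P : ColoredTriangulation n → Prop} (self : P T)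
    (flip : ∀ R S, ∀ c ∈ C, R ∈ faceVertices C T → IsColoredFlip c R S → P R → P S)
    (hS : S ∈ faceVertices C T) : P S := by
  replace hS := (SimpleGraph.reachable_iff_reflTransGen _ _).1 hS
  induction hS with
  | refl => exact self
  | tail hR hRS ih =>
    obtain ⟨c, hc, h⟩ := hRS
    exact flip _ _ c hc ((SimpleGraph.reachable_iff_reflTransGen _ _).2 hR) h ih

theorem fixedDiagonals_eq_of_mem (hS : S ∈ faceVertices C T) :
    fixedDiagonals C S = fixedDiagonals C T :=
  faceVertices_induction (P := fun S => fixedDiagonals C S = fixedDiagonals C T) rfl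
    (fun _ _ _ hc _ h ih =>
      ((h.symm.fixedDiagonals_subset hc).antisymm (h.fixedDiagonals_subset hc)).trans ih) hS

theorem exists_mem_faceVertices_of_reflTransGen {s : SymTriangulation n}
    (h : Relation.ReflTransGen (FlipStep (fixedDiagonals C T)) T.supp s) :
    ∃ S ∈ faceVertices C T, S.supp = s := by
  induction h with
  | refl => exact ⟨T, self_mem_faceVertices, rfl⟩
  | tail _ hstep ih =>
    obtain ⟨R, hR, rfl⟩ := ih
    obtain ⟨-, hfix, x, y, hflip⟩ := hstep
    obtain ⟨S, rfl, hS⟩ := R.exists_isColoredFlip hflip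
    refine ⟨S, mem_faceVertices_of_isColoredFlip hR ?_ hS, rfl⟩
    by_contra hx
    rw [← fixedDiagonals_eq_of_mem hR] at hfix
    exact hflip.symm.2.1 (hfix ⟨hflip.1, hx⟩)

theorem image_supp_faceVertices (C : Set (Option (Fin n))) (T : ColoredTriangulation n) :
    ColoredTriangulation.supp '' faceVertices C T = {s | fixedDiagonals C T ⊆ s.diagonals} := by
  ext s
  constructor
  · rintro ⟨S, hS, rfl⟩
    rw [Set.mem_ofPred_eq, ← fixedDiagonals_eq_of_mem hS]
    exact Set.sep_subset _ _
  · exact fun hs => exists_mem_faceVertices_of_reflTransGen <|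
      SymTriangulation.reflTransGen_flipStep (fun _ => oppPair_mem_fixedDiagonals)
        (Set.sep_subset _ _) hs

/-- A flip moves a diagonal that is not fixed by `C'`, so its color lies in `C'`. -/
theorem faceVertices_subset (h : ColoredTriangulation.supp '' faceVertices C T ⊆
    ColoredTriangulation.supp '' faceVertices C' T) : faceVertices C T ⊆ faceVertices C' T := by
  refine fun _ => faceVertices_induction self_mem_faceVertices fun R S c hc hR hRS hR' => ?_
  refine mem_faceVertices_of_isColoredFlip hR' ?_ hRS
  have hS : S.supp ∈ ColoredTriangulation.supp '' faceVertices C' T :=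
    h ⟨S, mem_faceVertices_of_isColoredFlip hR hc hRS, rfl⟩
  obtain ⟨x, y, hflip, rfl, -⟩ := hRS
  by_contra hx
  rw [image_supp_faceVertices, Set.mem_ofPred_eq, ← fixedDiagonals_eq_of_mem hR'] at hS
  exact hflip.symm.2.1 (hS ⟨hflip.1, hx⟩)

theorem fixedDiagonals_image_color_diff {D : Set (Sym2 (Vertex n))} (hDT : D ⊆ T.supp.diagonals)
    (hD : ∀ x ∈ D, oppPair x ∈ D) : fixedDiagonals (T.color '' (T.supp.diagonals \ D)) T = D := by
  ext x
  refine ⟨fun ⟨hx, hxC⟩ => ?_, fun hx => ⟨hDT hx, ?_⟩⟩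
  · by_contra hxD
    exact hxC ⟨x, ⟨hx, hxD⟩, rfl⟩
  · rintro ⟨y, ⟨hy, hyD⟩, hxy⟩
    rcases ColoredTriangulation.eq_or_eq_oppPair_of_color_eq (hDT hx) hy hxy.symm with rfl | rfl
    exacts [hyD hx, hyD (hD x hx)]

end FaceVertices

namespace ColorfulCyclohedronFace

variable {F G : ColorfulCyclohedronFace n} {T : ColoredTriangulation n}

theorem exists_vertices_eq (hT : T ∈ F.vertices) : ∃ C, F.vertices = faceVertices C T := by
  rcases F.isFace with h | ⟨C, S, h⟩
  · exact absurd hT (by simp [h])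
  · rw [h] at hT
    exact ⟨C, h.trans (faceVertices_eq_of_mem hT).symm⟩

/-- The face of the ordinary cyclohedron obtained by forgetting the colors. -/
def uncolor (F : ColorfulCyclohedronFace n) : CyclohedronFace n where
  vertices := ColoredTriangulation.supp '' F.vertices
  isFace := by
    rcases F.isFace with h | ⟨C, T, h⟩
    · exact Or.inl (by rw [h, Set.image_empty])
    · exact Or.inr ⟨T.supp, fixedDiagonals C T, Set.sep_subset _ _,
        fun _ => oppPair_mem_fixedDiagonals, by rw [h, image_supp_faceVertices]⟩

theorem vertices_uncolor (F : ColorfulCyclohedronFace n) :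
    F.uncolor.vertices = ColoredTriangulation.supp '' F.vertices :=
  rfl

theorem uncolor_mono (h : F ≤ G) : F.uncolor ≤ G.uncolor :=
  Set.image_mono h

theorem uncolor_smul (σ : Equiv.Perm (Fin n)) (F : ColorfulCyclohedronFace n) :
    (σ • F).uncolor = F.uncolor :=
  CyclohedronFace.ext (Set.image_image _ _ _)

theorem uncolor_surjective : Function.Surjective (uncolor (n := n)) := by
  rintro ⟨V, rfl | ⟨t, D, hDt, hD, rfl⟩⟩
  · exact ⟨⟨∅, Or.inl rfl⟩, CyclohedronFace.ext (Set.image_empty _)⟩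
  · obtain ⟨T, rfl⟩ := t.exists_coloring
    refine ⟨⟨_, Or.inr ⟨T.color '' (T.supp.diagonals \ D), T, rfl⟩⟩, CyclohedronFace.ext ?_⟩
    rw [vertices_uncolor, image_supp_faceVertices, fixedDiagonals_image_color_diff hDt hD]

theorem le_of_uncolor_le (hF : T ∈ F.vertices) (hG : T ∈ G.vertices)
    (h : F.uncolor ≤ G.uncolor) : F ≤ G := by
  obtain ⟨C, hC⟩ := exists_vertices_eq hF
  obtain ⟨C', hC'⟩ := exists_vertices_eq hG
  change ColoredTriangulation.supp '' F.vertices ⊆ ColoredTriangulation.supp '' G.vertices at h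
  change F.vertices ⊆ G.vertices
  rw [hC, hC'] at h ⊢
  exact faceVertices_subset h

theorem exists_mem_vertices_smul (hT : T.supp ∈ G.uncolor.vertices) :
    ∃ σ : Equiv.Perm (Fin n), T ∈ (σ • G).vertices := by
  obtain ⟨S, hS, hST⟩ := hT
  obtain ⟨σ, hσ⟩ := ColoredTriangulation.exists_smul_eq hST
  exact ⟨σ, S, hS, hσ⟩

theorem exists_le_smul_of_uncolor_le (h : F.uncolor ≤ G.uncolor) :
    ∃ σ : Equiv.Perm (Fin n), F ≤ σ • G := by
  rcases F.vertices.eq_empty_or_nonempty with hF | ⟨T, hT⟩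
  · exact ⟨1, hF.trans_subset (Set.empty_subset _)⟩
  · obtain ⟨σ, hσ⟩ := exists_mem_vertices_smul (h ⟨T, hT, rfl⟩)
    exact ⟨σ, le_of_uncolor_le hT hσ (h.trans_eq (uncolor_smul σ G).symm)⟩

theorem exists_eq_smul_of_uncolor_eq (h : F.uncolor = G.uncolor) :
    ∃ σ : Equiv.Perm (Fin n), F = σ • G := by
  rcases F.vertices.eq_empty_or_nonempty with hF | ⟨T, hT⟩
  · have hG : G.vertices = ∅ := by
      rw [← Set.image_eq_empty (f := ColoredTriangulation.supp), ← vertices_uncolor, ← h,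
        vertices_uncolor, hF, Set.image_empty]
    exact ⟨1, by rw [one_smul]; exact ColorfulCyclohedronFace.ext (hF.trans hG.symm)⟩
  · obtain ⟨σ, hσ⟩ := exists_mem_vertices_smul (h.le ⟨T, hT, rfl⟩)
    have h' : F.uncolor = (σ • G).uncolor := h.trans (uncolor_smul σ G).symm
    exact ⟨σ, (le_of_uncolor_le hT hσ h'.le).antisymm (le_of_uncolor_le hσ hT h'.ge)⟩

end ColorfulCyclohedronFace

namespace QuotientFace

theorem orbit_surjective : Function.Surjective (orbit (n := n)) :=
  Quotient.exists_rep

theorem orbit_smul (σ : Equiv.Perm (Fin n)) (F : ColorfulCyclohedronFace n) :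
    orbit (σ • F) = orbit F :=
  Quotient.sound (s := MulAction.orbitRel _ _) ⟨σ, rfl⟩

/-- The face of the ordinary cyclohedron obtained by forgetting the colors of any face of the
orbit. -/
def uncolor : QuotientFace n → CyclohedronFace n :=
  Quotient.lift (s := MulAction.orbitRel (Equiv.Perm (Fin n)) (ColorfulCyclohedronFace n))
    ColorfulCyclohedronFace.uncolor (by
      rintro _ G ⟨σ, rfl⟩
      exact G.uncolor_smul σ)

theorem uncolor_bijective : Function.Bijective (uncolor (n := n)) := by
  constructor
  · refine orbit_surjective.forall₂.2 fun F G h => ?_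
    obtain ⟨σ, rfl⟩ := ColorfulCyclohedronFace.exists_eq_smul_of_uncolor_eq h
    exact orbit_smul σ G
  · intro V
    obtain ⟨F, rfl⟩ := ColorfulCyclohedronFace.uncolor_surjective V
    exact ⟨orbit F, rfl⟩

theorem uncolor_le_uncolor_iff {P Q : QuotientFace n} : P.uncolor ≤ Q.uncolor ↔ P ≤ Q := by
  constructor
  · intro h
    obtain ⟨F, rfl⟩ := orbit_surjective P
    obtain ⟨G, rfl⟩ := orbit_surjective Q
    obtain ⟨σ, hσ⟩ := ColorfulCyclohedronFace.exists_le_smul_of_uncolor_le h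
    exact ⟨F, σ • G, rfl, orbit_smul σ G, hσ⟩
  · rintro ⟨F, G, rfl, rfl, h⟩
    exact ColorfulCyclohedronFace.uncolor_mono h

end QuotientFace

end Cyclohedron

/-- The quotient of the colorful cyclohedron by the symmetric group acting on the `n` colors is
isomorphic, as a partially ordered set of faces, to the ordinary cyclohedron. -/
theorem theorem6p3 (n : ℕ) :
    Nonempty (Cyclohedron.QuotientFace n ≃o Cyclohedron.CyclohedronFace n) :=
  ⟨{ toEquiv := Equiv.ofBijective _ Cyclohedron.QuotientFace.uncolor_bijective
     map_rel_iff' := Cyclohedron.QuotientFace.uncolor_le_uncolor_iff }⟩
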